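/- Let $\kappa$ be a cardinal with $\omega_1\le\kappa\le\mathfrak c$, let $\lambda$ be the usual product probability measure on the Baire $\sigma$-algebra of $2^\kappa$, let $\mathfrak B$ be its measure algebra (Baire sets modulo $\lambda$-null sets), and let $\mathfrak B^+=\mathfrak B\setminus\{0\}$. Let $\{N_b: b\in\mathfrak B^+\}$ be an independent family of subsets of $\mathbb N$, i.e. $\bigcap_{b\in s}N_b\setminus\bigcup_{b\in t}N_b\ne\emptyset$ for all finite disjoint $s,t\subseteq\mathfrak B^+$. For $b\in\mathfrak B^+$ let $G_b\in\mathfrak B^{\mathbb N}$ be given by $G_b(n)=b$ if $n\in N_b$ and $G_b(n)=0$ otherwise. Let $\mathfrak A$ be the Boolean subalgebra of $\mathfrak B^{\mathbb N}$ generated by $\{G_b:b\in\mathfrak B^+\}$, and let $K$ be the Stone space of all ultrafilters on $\mathfrak A$. Let $S(K)\subseteq C(K)$ be the linear span of the characteristic functions of the clopen subsets of $K$, and let $\mathrm{Ba}(C(K),w)$ be the Baire $\sigma$-algebra of the weak topology of $C(K)$. Assume that $\mathfrak c$ is a Kunen cardinal, i.e. $\mathcal P(\mathfrak c\times\mathfrak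 c)=\mathcal P(\mathfrak c)\otimes\mathcal P(\mathfrak c)$. Then the restriction of the supremum norm to $S(K)$ is measurable with respect to the trace of $\mathrm{Ba}(C(K),w)$ on $S(K)$. -/

import Mathlib

open MeasureTheory
open scoped Cardinal

/-- `κ` is a Kunen cardinal: on a set of cardinality `κ` (here the canonical one, `κ.out`), the
product of two copies of the power set `σ`-algebra is the power set `σ`-algebra of the square. -/
def IsKunenCardinal (κ : Cardinal) : Prop :=
  (⊤ : MeasurableSpace (κ.out × κ.out)) =
    (⊤ : MeasurableSpace κ.out).prod (⊤ : MeasurableSpace κ.out)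

/-! ### Baire `σ`-algebras -/

/-- The Baire `σ`-algebra of a topological space: the smallest `σ`-algebra for which all
real-valued continuous functions are measurable. -/
@[reducible] def baireSigma (X : Type*) [TopologicalSpace X] : MeasurableSpace X :=
  ⨆ f : C(X, ℝ), MeasurableSpace.comap (f : X → ℝ) (borel ℝ)

/-- `Ba(E, w)`: the Baire `σ`-algebra of the weak topology of a real normed space `E`, as a
`σ`-algebra on `E`. -/
@[reducible] noncomputable def weakBaire (E : Type*) [NormedAddCommGroup E] [NormedSpace ℝ E] : MeasurableSpace E :=
  (baireSigma (WeakSpace ℝ E)).comap (toWeakSpace ℝ E)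

/-! ### The measure algebra of a measure -/

/-- Equality of measurable sets up to a null set. -/
def nullSetoid {Ω : Type*} [MeasurableSpace Ω] (μ : Measure Ω) :
    Setoid {s : Set Ω // MeasurableSet s} where
  r s t := (s : Set Ω) =ᵐ[μ] (t : Set Ω)
  iseqv := ⟨fun _ => Filter.EventuallyEq.rfl, fun h => h.symm, fun h h' => h.trans h'⟩

/-- The measure algebra of `μ`: measurable sets modulo `μ`-null sets. -/
def MeasureAlgebra {Ω : Type*} [MeasurableSpace Ω] (μ : Measure Ω) : Type _ :=
  Quotient (nullSetoid μ)

namespace MeasureAlgebra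

variable {Ω : Type*} [MeasurableSpace Ω] {μ : Measure Ω}

/-- The class of a measurable set. -/
def mk (μ : Measure Ω) (s : {s : Set Ω // MeasurableSet s}) : MeasureAlgebra μ :=
  Quotient.mk (nullSetoid μ) s

/-- The Boolean algebra structure induced by the set operations; the order is inclusion up to a
null set. -/
noncomputable instance instBooleanAlgebra : BooleanAlgebra (MeasureAlgebra μ) where
  le a b := Quotient.liftOn₂ a b (fun s t => (s : Set Ω) ≤ᵐ[μ] (t : Set Ω))
    (fun _ _ _ _ h h' => propext
      ⟨fun k => h.symm.le.trans (k.trans h'.le), fun k => h.le.trans (k.trans h'.symm.le)⟩)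
  le_refl a := by
    refine Quotient.inductionOn a fun s => ?_
    exact Filter.EventuallyLE.rfl
  le_trans a b c := by
    refine Quotient.inductionOn₃ a b c fun s t u h h' => ?_
    exact Filter.EventuallyLE.trans h h'
  le_antisymm a b := by
    refine Quotient.inductionOn₂ a b fun s t h h' => ?_
    exact Quotient.sound (Filter.EventuallyLE.antisymm h h')
  sup := Quotient.map₂ (fun s t => ⟨s ∪ t, s.2.union t.2⟩)
    (fun _ _ h _ _ h' => Filter.EventuallyEq.union h h')
  inf := Quotient.map₂ (fun s t => ⟨s ∩ t, s.2.inter t.2⟩)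
    (fun _ _ h _ _ h' => Filter.EventuallyEq.inter h h')
  compl := Quotient.map (fun s => ⟨(s : Set Ω)ᶜ, s.2.compl⟩)
    (fun _ _ h => Filter.EventuallyEq.compl h)
  top := mk μ ⟨Set.univ, MeasurableSet.univ⟩
  bot := mk μ ⟨∅, MeasurableSet.empty⟩
  le_sup_left a b := by
    refine Quotient.inductionOn₂ a b fun s t => ?_
    exact Filter.Eventually.of_forall fun _ h => Or.inl h
  le_sup_right a b := by
    refine Quotient.inductionOn₂ a b fun s t => ?_
    exact Filter.Eventually.of_forall fun _ h => Or.inr h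
  sup_le a b c := by
    refine Quotient.inductionOn₃ a b c fun s t u h h' => ?_
    exact Filter.Eventually.mp h (Filter.Eventually.mono h' fun _ k' k l => l.elim k k')
  inf_le_left a b := by
    refine Quotient.inductionOn₂ a b fun s t => ?_
    exact Filter.Eventually.of_forall fun _ h => h.1
  inf_le_right a b := by
    refine Quotient.inductionOn₂ a b fun s t => ?_
    exact Filter.Eventually.of_forall fun _ h => h.2
  le_inf a b c := by
    refine Quotient.inductionOn₃ a b c fun s t u h h' => ?_
    exact Filter.Eventually.mp h (Filter.Eventually.mono h' fun _ k' k l => ⟨k l, k' l⟩)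
  le_sup_inf a b c := by
    refine Quotient.inductionOn₃ a b c fun s t u => ?_
    exact Filter.Eventually.of_forall fun _ h =>
      h.1.elim Or.inl fun h1 => h.2.elim Or.inl fun h2 => Or.inr ⟨h1, h2⟩
  inf_compl_le_bot a := by
    refine Quotient.inductionOn a fun s => ?_
    exact Filter.Eventually.of_forall fun _ h => h.2 h.1
  top_le_sup_compl a := by
    refine Quotient.inductionOn a fun s => ?_
    exact Filter.Eventually.of_forall fun x _ => Classical.em (x ∈ (s : Set Ω))
  le_top a := by
    refine Quotient.inductionOn a fun s => ?_
    exact Filter.Eventually.of_forall fun _ _ => trivial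
  bot_le a := by
    refine Quotient.inductionOn a fun s => ?_
    exact Filter.Eventually.of_forall fun _ h => h.elim

end MeasureAlgebra

/-! ### The Stone space of a Boolean algebra -/

/-- The Stone space of a Boolean algebra: the set of its ultrafilters. -/
@[ext]
structure StoneSpace (A : Type*) [BooleanAlgebra A] where
  carrier : Set A
  top_mem : ⊤ ∈ carrier
  inf_mem : ∀ {a b : A}, a ∈ carrier → b ∈ carrier → a ⊓ b ∈ carrier
  mem_of_le : ∀ {a b : A}, a ∈ carrier → a ≤ b → b ∈ carrier
  bot_notMem : ⊥ ∉ carrier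
  mem_or_compl_mem : ∀ a : A, a ∈ carrier ∨ aᶜ ∈ carrier

namespace StoneSpace

variable {A : Type*} [BooleanAlgebra A]

/-- The set of all ultrafilters that contain `a`. -/
def hat (a : A) : Set (StoneSpace A) := {F | a ∈ F.carrier}

/-- The Stone topology, generated by the sets `hat a`. -/
instance instTopologicalSpace : TopologicalSpace (StoneSpace A) :=
  TopologicalSpace.generateFrom (Set.range hat)

instance instCompactSpace : CompactSpace (StoneSpace A) := by
  refine ⟨isCompact_iff_ultrafilter_le_nhds.2 fun U _ => ?_⟩
  refine ⟨⟨{a | hat a ∈ U}, ?_, ?_, ?_, ?_, ?_⟩, Set.mem_univ _, ?_⟩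
  · exact Filter.mem_of_superset Filter.univ_mem fun F _ => F.top_mem
  · intro a b ha hb
    exact Filter.mem_of_superset (Filter.inter_mem ha hb) fun F hF => F.inf_mem hF.1 hF.2
  · intro a b ha hab
    exact Filter.mem_of_superset ha fun F hF => F.mem_of_le hF hab
  · intro h
    have h0 : hat (⊥ : A) = ∅ := Set.eq_empty_of_forall_notMem fun F hF => F.bot_notMem hF
    exact U.empty_notMem (h0 ▸ h)
  · intro a
    refine Ultrafilter.union_mem_iff.1 ?_
    exact Filter.mem_of_superset Filter.univ_mem fun F _ => F.mem_or_compl_mem a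
  · rw [TopologicalSpace.nhds_generateFrom]
    refine le_iInf₂ fun s hs => ?_
    obtain ⟨hs1, a, rfl⟩ := hs
    exact Filter.le_principal_iff.2 hs1

end StoneSpace

/-- `S(K)`: the linear span in `C(K)` of the characteristic functions of the clopen subsets
of `K`. -/
def clopenSpan (K : Type*) [TopologicalSpace K] : Submodule ℝ C(K, ℝ) :=
  Submodule.span ℝ {f | ∃ U : Set K, IsClopen U ∧ (f : K → ℝ) = U.indicator 1}

/-! ### The construction of the compact space -/

/-- The usual product probability measure on `2 ^ I`, the product of the uniform measures on
`{0, 1}`. Its domain, the product `σ`-algebra, is the Baire `σ`-algebra of the compact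
space `2 ^ I`. -/
noncomputable def coinMeasure (I : Type*) : Measure (I → Bool) :=
  Measure.infinitePi fun _ => (PMF.uniformOfFintype Bool).toMeasure

/-- `𝔅`: the measure algebra of the usual product measure on `2 ^ I`. -/
abbrev CoinAlgebra (I : Type*) : Type _ := MeasureAlgebra (coinMeasure I)

/-- `B⁺`: the nonzero elements of a Boolean algebra. -/
abbrev PosElem (B : Type*) [BooleanAlgebra B] : Type _ := {b : B // b ≠ ⊥}

/-- Independence of a family of subsets of `ℕ`. -/
def IsIndependentFamily {ι : Type*} (N : ι → Set ℕ) : Prop :=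
  ∀ s t : Finset ι, Disjoint s t → ((⋂ b ∈ s, N b) \ ⋃ b ∈ t, N b).Nonempty

section Construction

variable {B : Type*} [BooleanAlgebra B]

open Classical in
/-- The element `G_b` of the countable power `B ^ ℕ`: it takes the value `b` on `N_b` and `0`
elsewhere. -/
noncomputable def genElem (N : PosElem B → Set ℕ) (b : PosElem B) : ℕ → B :=
  fun n => if n ∈ N b then (b : B) else ⊥

/-- `𝔄`: the subalgebra of `B ^ ℕ` generated by all `G_b`, `b ∈ B⁺`. -/
noncomputable def genAlgebra (N : PosElem B → Set ℕ) : BooleanSubalgebra (ℕ → B) :=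
  BooleanSubalgebra.closure (Set.range (genElem N))

/-- `K`: the Stone space of `𝔄`. -/
abbrev genSpace (N : PosElem B → Set ℕ) : Type _ := StoneSpace (genAlgebra N)

end Construction

universe u v

/-! The products `generatorProd N s`, for finite `s ⊆ 𝔅⁺`, span a space that contains `S(K)`. Let `m
s` be the measure of the meet of `s`; the product for `s` is zero when `m s = 0`. For every `D ⊆
𝔅⁺`, the map sending `∑ c s • generatorProd N s` to the sum of `c s * m s` over `s ⊆ D` is dominated
by the norm: independence gives a coordinate `n` at which the generators that occur equal `b` for `b
∈ D` and `0` otherwise, so there the combination becomes a simple function on `2^κ`, whose integral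
is the functional (`abs_linearCombination_weightOn_le`). By Hahn–Banach these functionals extend to
`C(K)`, hence are measurable.

Since `𝔅` has at most `𝔠` elements, the Kunen property shows that the families `{s | s ⊆ D}`
generate all families of finite subsets of `𝔅⁺` (`IsKunenCardinal.finsetSigma_eq_top`). So the sum
of `c s * m s` over any family of sets `s` is measurable. Rounding these coefficients encodes them
in a finite set that depends measurably on the vector even for the discrete `σ`-algebra; every
function of this set is measurable, and the norm is a limit of such functions
(`IsKunenCardinal.measurable_norm_sum`). -/

/-! ### Kunen cardinals and discrete `σ`-algebras -/

theorem exists_injective_cantor {Y : Type u} (hY : #Y ≤ 𝔠) :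
    ∃ e : Y → ℕ → Bool, Function.Injective e := by
  have h : Cardinal.lift.{0} #Y ≤ Cardinal.lift.{u} #(ℕ → Bool) := by simpa using hY
  obtain ⟨e⟩ := Cardinal.lift_mk_le'.1 h
  exact ⟨e, e.injective⟩

theorem mk_finset_le_continuum {Y : Type u} (hY : #Y ≤ 𝔠) : #(Finset Y) ≤ 𝔠 := by
  cases finite_or_infinite Y
  · exact (Cardinal.mk_le_aleph0).trans Cardinal.aleph0_le_continuum
  · rwa [Cardinal.mk_finset_of_infinite]

theorem IsKunenCardinal.measurableSet_prod (hc : IsKunenCardinal.{0} 𝔠) {Y : Type u} {Y' : Type v}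
    (hY : #Y ≤ 𝔠) (hY' : #Y' ≤ 𝔠) (W : Set (Y × Y')) :
    MeasurableSet[(⊤ : MeasurableSpace Y).prod (⊤ : MeasurableSpace Y')] W := by
  have h : Cardinal.lift.{0} #Y ≤ Cardinal.lift.{u} #(𝔠 : Cardinal.{0}).out := by simpa using hY
  have h' : Cardinal.lift.{0} #Y' ≤ Cardinal.lift.{v} #(𝔠 : Cardinal.{0}).out := by
    simpa using hY'
  obtain ⟨i⟩ := Cardinal.lift_mk_le'.1 h
  obtain ⟨j⟩ := Cardinal.lift_mk_le'.1 h'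
  have hm : @Measurable _ _ ((⊤ : MeasurableSpace Y).prod (⊤ : MeasurableSpace Y'))
      ((⊤ : MeasurableSpace (𝔠 : Cardinal.{0}).out).prod
        (⊤ : MeasurableSpace (𝔠 : Cardinal.{0}).out)) (Prod.map i j) := by
    let : MeasurableSpace Y := ⊤
    let : MeasurableSpace Y' := ⊤
    let : MeasurableSpace (𝔠 : Cardinal.{0}).out := ⊤
    exact Measurable.prodMap measurable_from_top measurable_from_top
  rw [← (i.injective.prodMap j.injective).preimage_image W]
  refine hm ?_
  have hc' := hc
  unfold IsKunenCardinal at hc'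
  rw [← hc']
  trivial

/-- This is how the Kunen property gets used: a pair of measurable maps into discrete spaces stays
measurable into the discrete product, so any function of the pair is measurable. -/
theorem IsKunenCardinal.measurable_comp_prodMk (hc : IsKunenCardinal.{0} 𝔠) {Y : Type u}
    {Y' : Type v} {α T : Type*} [MeasurableSpace α] (hY : #Y ≤ 𝔠) (hY' : #Y' ≤ 𝔠)
    {f : α → Y} {g : α → Y'} (hf : Measurable[_, ⊤] f) (hg : Measurable[_, ⊤] g)
    (h : Y × Y' → T) : Measurable[_, ⊤] fun x => h (f x, g x) := by
  let : MeasurableSpace Y := ⊤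
  let : MeasurableSpace Y' := ⊤
  intro W _
  exact (hf.prodMk hg) (hc.measurableSet_prod hY hY' (h ⁻¹' W))

/-! ### Families of finite sets -/

/-- The cells of a point of `Y` along a map from `Y` to the Cantor space. -/
def cantorCell {Y : Type*} (e : Y → ℕ → Bool) (m : ℕ) (y : Y) : Fin m → Bool := fun i => e y i

theorem eventually_injOn_cantorCell {Y : Type*} {e : Y → ℕ → Bool} (he : Function.Injective e)
    (s : Finset Y) : ∀ᶠ m in Filter.atTop, Set.InjOn (cantorCell e m) s := by
  have h : ∀ x ∈ s, ∀ y ∈ s, ∀ᶠ m in Filter.atTop, cantorCell e m x = cantorCell e m y → x = y := by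
    intro x _ y _
    by_cases hxy : x = y
    · exact Filter.Eventually.of_forall fun _ _ => hxy
    · obtain ⟨i, hi⟩ := Function.ne_iff.1 (he.ne hxy)
      filter_upwards [Filter.eventually_gt_atTop i] with m hm hxm
      exact (hi (congrFun hxm ⟨i, hm⟩)).elim
  have h' := (Filter.eventually_all_finset s).2 fun x hx => (Filter.eventually_all_finset s).2 (h x hx)
  filter_upwards [h'] with m hm x hx y hy hxy
  exact hm x hx y hy hxy

/-- The `σ`-algebra on the finite subsets of `Y` generated by the families of all finite
subsets of a given set. -/
@[reducible] def finsetSigma (Y : Type*) : MeasurableSpace (Finset Y) :=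
  MeasurableSpace.generateFrom (Set.range fun D : Set Y => {s : Finset Y | (s : Set Y) ⊆ D})

theorem isPiSystem_finset_subset (Y : Type*) :
    IsPiSystem (Set.range fun D : Set Y => {s : Finset Y | (s : Set Y) ⊆ D}) := by
  rintro _ ⟨D, rfl⟩ _ ⟨E, rfl⟩ _
  exact ⟨D ∩ E, by ext s; simp [Set.subset_inter_iff]⟩

theorem measurableSet_finsetSigma_subset {Y : Type*} (D : Set Y) :
    MeasurableSet[finsetSigma Y] {s : Finset Y | (s : Set Y) ⊆ D} :=
  MeasurableSpace.measurableSet_generateFrom ⟨D, rfl⟩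

theorem measurableSet_finsetSigma_exists {Y : Type*} (D : Set Y) :
    MeasurableSet[finsetSigma Y] {s : Finset Y | ∃ y ∈ s, y ∈ D} := by
  convert (measurableSet_finsetSigma_subset Dᶜ).compl using 1
  ext s
  simp [Set.subset_def]

open Classical in
/-- The part of `s` in `C`, if it has at most one element, and the empty set otherwise. -/
noncomputable def singlePart {Y : Type*} (C : Set Y) (s : Finset Y) : Finset Y :=
  if {y | y ∈ s ∧ y ∈ C}.Subsingleton then {y ∈ s | y ∈ C} else ∅

/-- Two distinct points of `s ∩ C` differ in some coordinate of `e`, so the complement is a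
countable union of conditions that `s` meets two given sets. -/
theorem measurableSet_finsetSigma_subsingleton {Y : Type*} {e : Y → ℕ → Bool}
    (he : Function.Injective e) (C : Set Y) :
    MeasurableSet[finsetSigma Y] {s : Finset Y | {y | y ∈ s ∧ y ∈ C}.Subsingleton} := by
  let := finsetSigma Y
  have h : {s : Finset Y | {y | y ∈ s ∧ y ∈ C}.Subsingleton} =
      ⋂ i : ℕ, ({s : Finset Y | ∃ y ∈ s, y ∈ C ∩ {y | e y i = true}} ∩
        {s : Finset Y | ∃ y ∈ s, y ∈ C ∩ {y | e y i = false}})ᶜ := by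
    ext s
    simp only [Set.mem_ofPred_eq, Set.mem_iInter, Set.mem_compl_iff, Set.mem_inter_iff, not_and,
      not_exists]
    constructor
    · rintro h i ⟨x, hx, hxC, hxi⟩ y hy hyC hyi
      have := h ⟨hx, hxC⟩ ⟨hy, hyC⟩
      subst this
      simp_all
    · rintro h x ⟨hx, hxC⟩ y ⟨hy, hyC⟩
      refine he (funext fun i => ?_)
      cases hxi : e x i <;> cases hyi : e y i
      · rfl
      · exact (h i ⟨y, hy, hyC, hyi⟩ x hx hxC hxi).elim
      · exact (h i ⟨x, hx, hxC, hxi⟩ y hy hyC hyi).elim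
      · rfl
  rw [h]
  exact MeasurableSet.iInter fun i => ((measurableSet_finsetSigma_exists _).inter
    (measurableSet_finsetSigma_exists _)).compl

/-- When `s ∩ C` is a single point `y`, the condition `{y} ∈ W` says that `s` meets a fixed subset
of `C`. -/
theorem measurable_singlePart {Y : Type*} {e : Y → ℕ → Bool} (he : Function.Injective e)
    (C : Set Y) : Measurable[finsetSigma Y, ⊤] (singlePart C) := by
  classical
  let := finsetSigma Y
  intro W _
  have h1 := measurableSet_finsetSigma_subsingleton he C
  have h : singlePart C ⁻¹' W =
      ({s : Finset Y | {y | y ∈ s ∧ y ∈ C}.Subsingleton} ∩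
        {s | ∃ y ∈ s, y ∈ C ∩ {y | {y} ∈ W}}) ∪
      (({s : Finset Y | {y | y ∈ s ∧ y ∈ C}.Subsingleton} ∩ {s | ∃ y ∈ s, y ∈ C})ᶜ ∩
        {_s | ∅ ∈ W}) := by
    ext s
    by_cases hs : {y | y ∈ s ∧ y ∈ C}.Subsingleton
    · by_cases hC : ∃ y ∈ s, y ∈ C
      · obtain ⟨y, hy, hyC⟩ := hC
        have h2 : {y ∈ s | y ∈ C} = {y} := by
          ext z
          simp only [Finset.mem_filter, Finset.mem_singleton]
          exact ⟨fun hz => hs hz ⟨hy, hyC⟩, fun hz => hz ▸ ⟨hy, hyC⟩⟩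
        have h3 : (∃ z ∈ s, z ∈ C ∧ {z} ∈ W) ↔ {y} ∈ W :=
          ⟨fun ⟨z, hz, hzC, hzW⟩ => hs ⟨hz, hzC⟩ ⟨hy, hyC⟩ ▸ hzW, fun hW => ⟨y, hy, hyC, hW⟩⟩
        have h4 : ∃ y ∈ s, y ∈ C := ⟨y, hy, hyC⟩
        simp [singlePart, hs, h2, h3, h4]
      · have h2 : {y ∈ s | y ∈ C} = ∅ := by
          ext z
          simp only [Finset.mem_filter, Finset.notMem_empty, iff_false]
          exact fun hz => hC ⟨z, hz⟩
        have h3 : ¬ ∃ z ∈ s, z ∈ C ∧ {z} ∈ W := fun ⟨z, hz, hzC, _⟩ => hC ⟨z, hz, hzC⟩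
        simp only [Set.mem_preimage, singlePart, if_pos hs, h2]
        simp [hs, h3, hC]
    · simp [singlePart, hs]
  rw [h]
  exact (h1.inter (measurableSet_finsetSigma_exists _)).union
    ((h1.inter (measurableSet_finsetSigma_exists _)).compl.inter (MeasurableSet.const _))

/-- For large `m` the cells separate the points of `s`, and `s` is the union of its parts in the
cells. The Kunen property keeps finite unions of these parts measurable into the discrete space, so
`W` is a countable lower limit of measurable families. -/
theorem IsKunenCardinal.finsetSigma_eq_top (hc : IsKunenCardinal.{0} 𝔠) {Y : Type u}
    (hY : #Y ≤ 𝔠) : finsetSigma Y = ⊤ := by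
  classical
  obtain ⟨e, he⟩ := exists_injective_cantor hY
  have hF := mk_finset_le_continuum hY
  let := finsetSigma Y
  have hcell : ∀ (m : ℕ) (T : Finset (Fin m → Bool)), Measurable[finsetSigma Y, ⊤]
      fun s : Finset Y => T.biUnion fun c => singlePart (cantorCell e m ⁻¹' {c}) s := by
    intro m T
    induction T using Finset.induction_on with
    | empty =>
      simp only [Finset.biUnion_empty]
      exact @measurable_const _ _ ⊤ _ _
    | insert c T _ ih =>
      simp only [Finset.biUnion_insert]
      exact hc.measurable_comp_prodMk hF hF (measurable_singlePart he _) ih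
        fun q => q.1 ∪ q.2
  refine top_le_iff.1 fun W _ => ?_
  have h : W = {s | ∀ᶠ m in Filter.atTop,
      (Finset.univ.biUnion fun c => singlePart (cantorCell e m ⁻¹' {c}) s) ∈ W} := by
    ext s
    have hs : ∀ᶠ m in Filter.atTop,
        (Finset.univ.biUnion fun c => singlePart (cantorCell e m ⁻¹' {c}) s) = s := by
      filter_upwards [eventually_injOn_cantorCell he s] with m hm
      have hsub : ∀ c, {y | y ∈ s ∧ y ∈ cantorCell e m ⁻¹' {c}}.Subsingleton := by
        rintro c x ⟨hx, hxc⟩ y ⟨hy, hyc⟩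
        exact hm hx hy (hxc.trans hyc.symm)
      have hpart : ∀ c, singlePart (cantorCell e m ⁻¹' {c}) s = {y ∈ s | cantorCell e m y = c} :=
        fun c => by
          rw [singlePart, if_pos (hsub c)]
          ext y
          simp
      ext y
      simp [hpart]
    rw [Set.mem_ofPred_eq, Filter.eventually_congr (hs.mono fun m hm => by rw [hm])]
    exact Filter.eventually_const.symm
  rw [h]
  simp only [Filter.eventually_atTop, Set.ofPred_exists, Set.ofPred_forall]
  exact MeasurableSet.iUnion fun M => MeasurableSet.iInter fun m => MeasurableSet.iInter fun _ =>
    hcell m Finset.univ (t := W) trivial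

/-! ### Measurability of finitely supported coefficients -/

/-- The sum of the values of a finitely supported function over a set. -/
noncomputable def sumOn {Z : Type*} (W : Set Z) (a : Z →₀ ℝ) : ℝ := ∑ z ∈ a.support, W.indicator a z

theorem sumOn_compl {Z : Type*} (W : Set Z) (a : Z →₀ ℝ) :
    sumOn Wᶜ a = sumOn Set.univ a - sumOn W a := by
  rw [sumOn, sumOn, sumOn, Set.indicator_univ, ← Finset.sum_sub_distrib]
  exact Finset.sum_congr rfl fun z _ => congrFun (Set.indicator_compl W a) z

theorem hasSum_sumOn_iUnion {Z : Type*} (f : ℕ → Set Z) (hf : Pairwise (Function.onFun Disjoint f))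
    (a : Z →₀ ℝ) : HasSum (fun i => sumOn (f i) a) (sumOn (⋃ i, f i) a) := by
  refine hasSum_sum fun z _ => ?_
  by_cases hz : z ∈ ⋃ i, f i
  · obtain ⟨i, hi⟩ := Set.mem_iUnion.1 hz
    rw [Set.indicator_of_mem hz]
    convert hasSum_single (f := fun j => (f j).indicator a z) i ?_ using 1
    · rw [Set.indicator_of_mem hi]
    · intro j hj
      rw [Set.indicator_of_notMem]
      exact fun hzj => Set.disjoint_left.1 (hf hj) hzj hi
  · rw [Set.indicator_of_notMem hz]
    convert hasSum_zero using 2 with i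
    rw [Set.indicator_of_notMem]
    exact fun h => hz (Set.mem_iUnion.2 ⟨i, h⟩)

/-- The sums are countably additive in `W`, so the π-λ theorem passes from the generating π-system
to all families. -/
theorem IsKunenCardinal.measurable_sumOn (hc : IsKunenCardinal.{0} 𝔠) {Y : Type u} (hY : #Y ≤ 𝔠)
    {S : Type*} [MeasurableSpace S] {a : S → Finset Y →₀ ℝ}
    (ha : ∀ D : Set Y, Measurable fun x => sumOn {s : Finset Y | (s : Set Y) ⊆ D} (a x))
    (W : Set (Finset Y)) : Measurable fun x => sumOn W (a x) := by
  have huniv : Measurable fun x => sumOn Set.univ (a x) := by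
    simpa using ha Set.univ
  refine MeasurableSpace.induction_on_inter (m := finsetSigma Y)
    (C := fun W _ => Measurable fun x => sumOn W (a x)) rfl (isPiSystem_finset_subset Y)
    ?_ ?_ ?_ ?_ W ?_
  · simp [sumOn]
  · rintro _ ⟨D, rfl⟩
    exact ha D
  · intro t _ ht
    simp only [sumOn_compl]
    exact huniv.sub ht
  · intro f hf _ h
    refine measurable_of_tendsto_metrizable (f := fun n x => ∑ i ∈ Finset.range n, sumOn (f i) (a x))
      (fun n => Finset.measurable_sum _ fun i _ => h i) ?_
    exact tendsto_pi_nhds.2 fun x => (hasSum_sumOn_iUnion f hf (a x)).tendsto_sum_nat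
  · rw [hc.finsetSigma_eq_top hY]
    trivial

/-- Once the cells separate the support, the sum over the part of a cell in `D` is a single value or
zero. -/
theorem measurableSet_exists_support_mem {Z : Type u} (hZ : #Z ≤ 𝔠) {S : Type*} [MeasurableSpace S]
    {a : S → Z →₀ ℝ} (ha : ∀ W : Set Z, Measurable fun x => sumOn W (a x)) (D : Set Z)
    {B : Set ℝ} (hB : MeasurableSet B) : MeasurableSet {x | ∃ z ∈ (a x).support, z ∈ D ∧ a x z ∈ B} := by
  obtain ⟨e, he⟩ := exists_injective_cantor hZ
  -- Removing `0` discards the cells without a support point in `D`.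
  have h : {x | ∃ z ∈ (a x).support, z ∈ D ∧ a x z ∈ B} = {x | ∀ᶠ m in Filter.atTop,
      ∃ c : Fin m → Bool, sumOn (D ∩ cantorCell e m ⁻¹' {c}) (a x) ∈ B \ {0}} := by
    ext x
    have hx : ∀ᶠ m in Filter.atTop, (∃ z ∈ (a x).support, z ∈ D ∧ a x z ∈ B) ↔
        ∃ c : Fin m → Bool, sumOn (D ∩ cantorCell e m ⁻¹' {c}) (a x) ∈ B \ {0} := by
      filter_upwards [eventually_injOn_cantorCell he (a x).support] with m hm
      have hone : ∀ z ∈ (a x).support, z ∈ D →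
          sumOn (D ∩ cantorCell e m ⁻¹' {cantorCell e m z}) (a x) = a x z := by
        intro z hz hzD
        rw [sumOn, Finset.sum_eq_single_of_mem z hz]
        · exact Set.indicator_of_mem (show z ∈ D ∩ cantorCell e m ⁻¹' {cantorCell e m z} from ⟨hzD, rfl⟩) _
        · intro y hy hyz
          exact Set.indicator_of_notMem (fun h => hyz (hm hy hz h.2)) _
      constructor
      · rintro ⟨z, hz, hzD, hzB⟩
        refine ⟨cantorCell e m z, ?_⟩
        rw [hone z hz hzD]
        exact ⟨hzB, Finsupp.mem_support_iff.1 hz⟩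
      · rintro ⟨c, hcB, hc0⟩
        obtain ⟨z, hz, hz0⟩ := Finset.exists_ne_zero_of_sum_ne_zero (show sumOn _ _ ≠ 0 from hc0)
        obtain ⟨hzD, rfl⟩ := Set.mem_of_indicator_ne_zero hz0
        exact ⟨z, hz, hzD, hone z hz hzD ▸ hcB⟩
    rw [Set.mem_ofPred_eq, Set.mem_ofPred_eq, ← Filter.eventually_congr hx]
    exact Filter.eventually_const.symm
  rw [h]
  simp only [Filter.eventually_atTop, Set.ofPred_exists, Set.ofPred_forall]
  exact MeasurableSet.iUnion fun M => MeasurableSet.iInter fun m => MeasurableSet.iInter fun _ =>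
    MeasurableSet.iUnion fun c => ha _ (hB.diff (measurableSet_singleton 0))

open Classical in
/-- The points of the support of `a`, paired with the integer parts of the values of `n * a`. -/
noncomputable def floorGraph {Z : Type*} (n : ℕ) (a : Z →₀ ℝ) : Finset (Z × ℤ) :=
  a.support.image fun z => (z, ⌊n * a z⌋)

/-- By `finsetSigma_eq_top` on `Z × ℤ`, only inclusion of the graph in a set needs checking; this
splits over the countably many integer values. -/
theorem IsKunenCardinal.measurable_floorGraph (hc : IsKunenCardinal.{0} 𝔠) {Z : Type u}
    (hZ : #Z ≤ 𝔠) {S : Type*} [MeasurableSpace S] {a : S → Z →₀ ℝ}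
    (ha : ∀ W : Set Z, Measurable fun x => sumOn W (a x)) (n : ℕ) :
    Measurable[_, ⊤] fun x => floorGraph n (a x) := by
  have hZZ : #(Z × ℤ) ≤ 𝔠 := by
    rw [Cardinal.mk_prod]
    simpa using mul_le_mul' hZ Cardinal.aleph0_le_continuum
  rw [← hc.finsetSigma_eq_top hZZ]
  refine measurable_generateFrom ?_
  rintro _ ⟨D, rfl⟩
  have h : (fun x => floorGraph n (a x)) ⁻¹' {s : Finset (Z × ℤ) | (s : Set (Z × ℤ)) ⊆ D} =
      ⋂ k : ℤ, {x | ∃ z ∈ (a x).support, z ∈ {z | (z, k) ∉ D} ∧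
        a x z ∈ (fun r : ℝ => ⌊n * r⌋) ⁻¹' {k}}ᶜ := by
    ext x
    simp [floorGraph, Set.subset_def]
    grind
  rw [h]
  refine MeasurableSet.iInter fun k => (measurableSet_exists_support_mem hZ ha _ ?_).compl
  exact (Int.measurable_floor.comp (measurable_const.mul measurable_id)) (measurableSet_singleton k)

theorem tendsto_floor_mul_div_atTop (r : ℝ) :
    Filter.Tendsto (fun n : ℕ => (⌊n * r⌋ : ℝ) / n) Filter.atTop (nhds r) := by
  have h : Filter.Tendsto (fun n : ℕ => r - 1 / (n : ℝ)) Filter.atTop (nhds r) := by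
    simpa using tendsto_const_nhds.sub (tendsto_one_div_atTop_nhds_zero_nat (𝕜 := ℝ))
  refine tendsto_of_tendsto_of_tendsto_of_le_of_le' h tendsto_const_nhds ?_ ?_
  · filter_upwards [Filter.eventually_gt_atTop 0] with n hn
    have hn' : (0 : ℝ) < n := by exact_mod_cast hn
    rw [le_div_iff₀ hn', sub_mul, one_div_mul_cancel hn'.ne']
    linarith [Int.sub_one_lt_floor (n * r)]
  · filter_upwards [Filter.eventually_gt_atTop 0] with n hn
    have hn' : (0 : ℝ) < n := by exact_mod_cast hn
    rw [div_le_iff₀ hn']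
    linarith [Int.floor_le (n * r)]

/-- After rounding, the norm depends only on a finite set from a discrete space, so nothing is asked
of `v`. -/
theorem IsKunenCardinal.measurable_norm_sum (hc : IsKunenCardinal.{0} 𝔠) {Z : Type u}
    (hZ : #Z ≤ 𝔠) {S : Type*} [MeasurableSpace S] {a : S → Z →₀ ℝ}
    (ha : ∀ W : Set Z, Measurable fun x => sumOn W (a x)) {E : Type*} [NormedAddCommGroup E]
    [NormedSpace ℝ E] (v : Z → E) : Measurable fun x => ‖(a x).sum fun z r => r • v z‖ := by
  classical
  refine measurable_of_tendsto_metrizable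
    (f := fun n x => ‖∑ q ∈ floorGraph n (a x), ((q.2 : ℝ) / n) • v q.1‖) (fun n => ?_) ?_
  · let : MeasurableSpace (Finset (Z × ℤ)) := ⊤
    exact (measurable_from_top (f := fun s : Finset (Z × ℤ) => ‖∑ q ∈ s, ((q.2 : ℝ) / n) • v q.1‖)).comp
      (hc.measurable_floorGraph hZ ha n)
  · refine tendsto_pi_nhds.2 fun x => ?_
    have h : ∀ n, ∑ q ∈ floorGraph n (a x), ((q.2 : ℝ) / n) • v q.1 =
        ∑ z ∈ (a x).support, ((⌊n * a x z⌋ : ℝ) / n) • v z := by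
      intro n
      rw [floorGraph, Finset.sum_image]
      intro y _ z _ hyz
      exact congrArg Prod.fst hyz
    simp only [h]
    refine (tendsto_finsetSum _ fun z _ => ?_).norm
    refine Filter.Tendsto.smul_const ?_ _
    exact tendsto_floor_mul_div_atTop _

/-! ### Size of the measure algebra, and weakly measurable functionals -/

theorem mk_coinAlgebra_le_continuum {I : Type u} (hI : #I ≤ 𝔠) : #(CoinAlgebra I) ≤ 𝔠 := by
  refine (Cardinal.mk_quotient_le).trans ?_
  have hle : (MeasurableSpace.pi : MeasurableSpace (I → Bool)) ≤ MeasurableSpace.generateFrom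
      (Set.range fun i : I => (fun x : I → Bool => x i) ⁻¹' {true}) := by
    refine iSup_le fun i => ?_
    rw [← measurable_iff_comap_le]
    exact @measurable_to_bool _ (_) _ (MeasurableSpace.measurableSet_generateFrom ⟨i, rfl⟩)
  exact (Cardinal.mk_le_mk_of_subset fun t ht => hle t ht).trans
    (MeasurableSpace.cardinal_measurableSet_le_continuum (Cardinal.mk_range_le.trans hI))

/-- Bounded linear functionals are measurable for the Baire `σ`-algebra of the weak topology. -/
theorem measurable_weakBaire {E : Type*} [NormedAddCommGroup E] [NormedSpace ℝ E]
    (φ : E →L[ℝ] ℝ) : Measurable[weakBaire E, borel ℝ] φ := by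
  let ψ : C(WeakSpace ℝ E, ℝ) :=
    ⟨fun x => φ ((toWeakSpace ℝ E).symm x), WeakBilin.eval_continuous (topDualPairing ℝ E).flip φ⟩
  have h1 : Measurable[baireSigma (WeakSpace ℝ E), borel ℝ] ψ := by
    rw [measurable_iff_comap_le]
    exact le_iSup (fun f : C(WeakSpace ℝ E, ℝ) =>
      MeasurableSpace.comap (f : WeakSpace ℝ E → ℝ) (borel ℝ)) ψ
  exact @Measurable.comp _ _ _ (weakBaire E) (baireSigma (WeakSpace ℝ E)) (borel ℝ) _ _ h1
    (@comap_measurable _ _ (baireSigma (WeakSpace ℝ E)) _)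

/-- A linear functional that is dominated by the norm of a linear map factors through it. -/
theorem exists_dual_comp_eq {V E : Type*} [AddCommGroup V] [Module ℝ V] [NormedAddCommGroup E]
    [NormedSpace ℝ E] (L : V →ₗ[ℝ] E) (M : V →ₗ[ℝ] ℝ) (h : ∀ v, |M v| ≤ ‖L v‖) :
    ∃ φ : E →L[ℝ] ℝ, ∀ v, φ (L v) = M v := by
  obtain ⟨g, hg⟩ := L.rangeRestrict.exists_rightInverse_of_surjective L.range_rangeRestrict
  have hg' : ∀ y, L (g y) = y := fun y => congrArg Subtype.val (LinearMap.congr_fun hg y)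
  let f : LinearMap.range L →L[ℝ] ℝ := (M ∘ₗ g).mkContinuous 1 fun y => by
    have := h (g y)
    rw [hg' y] at this
    simpa using this
  obtain ⟨φ, hφ, -⟩ := exists_extension_norm_eq (LinearMap.range L) f
  refine ⟨φ, fun v => ?_⟩
  have h1 : φ (L v) = M (g ⟨L v, v, rfl⟩) := hφ ⟨L v, v, rfl⟩
  -- `L` kills this difference, so the domination makes `M` kill it too.
  have h2 : |M (g ⟨L v, v, rfl⟩ - v)| ≤ 0 := by
    refine (h _).trans ?_
    rw [map_sub, hg', sub_self, norm_zero]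
  rw [h1, ← sub_eq_zero, ← map_sub]
  exact abs_nonpos_iff.1 h2

/-! ### Representatives and Stone spaces -/

namespace MeasureAlgebra

variable {Ω : Type*} [MeasurableSpace Ω] {μ : Measure Ω}

/-- A measurable set that represents an element of the measure algebra. -/
noncomputable def rep (b : MeasureAlgebra μ) : Set Ω :=
  (Quotient.out (s := nullSetoid μ) b : {s : Set Ω // MeasurableSet s})

theorem measurableSet_rep (b : MeasureAlgebra μ) : MeasurableSet b.rep :=
  (Quotient.out (s := nullSetoid μ) b : {s : Set Ω // MeasurableSet s}).2

theorem mk_rep (b : MeasureAlgebra μ) : mk μ ⟨b.rep, b.measurableSet_rep⟩ = b :=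
  Quotient.out_eq (s := nullSetoid μ) b

end MeasureAlgebra

namespace StoneSpace

theorem compl_mem_iff {A : Type*} [BooleanAlgebra A] (F : StoneSpace A) (a : A) :
    aᶜ ∈ F.carrier ↔ a ∉ F.carrier := by
  refine ⟨fun h h' => F.bot_notMem ?_, fun h => (F.mem_or_compl_mem a).resolve_left h⟩
  simpa using F.inf_mem h' h

theorem inf_mem_iff {A : Type*} [BooleanAlgebra A] (F : StoneSpace A) (a b : A) :
    a ⊓ b ∈ F.carrier ↔ a ∈ F.carrier ∧ b ∈ F.carrier :=
  ⟨fun h => ⟨F.mem_of_le h inf_le_left, F.mem_of_le h inf_le_right⟩, fun h => F.inf_mem h.1 h.2⟩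

theorem sup_mem_iff {A : Type*} [BooleanAlgebra A] (F : StoneSpace A) (a b : A) :
    a ⊔ b ∈ F.carrier ↔ a ∈ F.carrier ∨ b ∈ F.carrier := by
  rw [← not_iff_not, ← compl_mem_iff, compl_sup, inf_mem_iff, compl_mem_iff, compl_mem_iff, not_or]

theorem isClopen_hat {A : Type*} [BooleanAlgebra A] (a : A) : IsClopen (hat a) := by
  have h : ∀ b : A, IsOpen (hat b) := fun b => TopologicalSpace.isOpen_generateFrom_of_mem ⟨b, rfl⟩
  refine ⟨⟨?_⟩, h a⟩
  convert h aᶜ using 1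
  ext F
  exact (F.compl_mem_iff a).symm

theorem exists_eq_hat_of_isClopen {A : Type*} [BooleanAlgebra A] {U : Set (StoneSpace A)}
    (hU : IsClopen U) : ∃ a : A, U = hat a := by
  have hb : TopologicalSpace.IsTopologicalBasis (insert Set.univ (Set.range (hat (A := A)))) := by
    refine TopologicalSpace.isTopologicalBasis_of_subbasis_of_inter rfl ?_
    rintro _ ⟨a, rfl⟩ _ ⟨b, rfl⟩
    exact ⟨a ⊓ b, Set.ext fun F => F.inf_mem_iff a b⟩
  have huniv : (Set.univ : Set (StoneSpace A)) = hat ⊤ :=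
    (Set.eq_univ_of_forall fun F => F.top_mem).symm
  obtain ⟨a, h1, h2⟩ : ∃ a : A, U ⊆ hat a ∧ hat a ⊆ U := by
    refine hU.isClosed.isCompact.induction_on (p := fun s => ∃ a : A, s ⊆ hat a ∧ hat a ⊆ U)
      ⟨⊥, Set.empty_subset _, fun F hF => (F.bot_notMem hF).elim⟩
      (fun s t hst ⟨a, h1, h2⟩ => ⟨a, hst.trans h1, h2⟩) ?_ ?_
    · rintro s t ⟨a, h1, h2⟩ ⟨b, h3, h4⟩
      refine ⟨a ⊔ b, ?_, ?_⟩
      · rintro F (hF | hF)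
        · exact (F.sup_mem_iff a b).2 (Or.inl (h1 hF))
        · exact (F.sup_mem_iff a b).2 (Or.inr (h3 hF))
      · intro F hF
        exact ((F.sup_mem_iff a b).1 hF).elim (fun h => h2 h) (fun h => h4 h)
    · intro F hF
      obtain ⟨V, hV, hFV, hVU⟩ := hb.exists_subset_of_mem_open hF hU.isOpen
      obtain ⟨a, rfl⟩ : ∃ a, V = hat a := by
        rcases hV with rfl | ⟨a, rfl⟩
        exacts [⟨⊤, huniv⟩, ⟨a, rfl⟩]
      exact ⟨hat a, mem_nhdsWithin_of_mem_nhds ((isClopen_hat a).isOpen.mem_nhds hFV), a,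
        subset_rfl, hVU⟩
  exact ⟨a, h1.antisymm h2⟩

/-- The point of the Stone space of a subalgebra of `B ^ ℕ` given by a coordinate and a point of
the Stone space of `B`. -/
def ofCoord {B : Type*} [BooleanAlgebra B] {L : BooleanSubalgebra (ℕ → B)} (n : ℕ)
    (F : StoneSpace B) : StoneSpace L where
  carrier := {A | (A : ℕ → B) n ∈ F.carrier}
  top_mem := F.top_mem
  inf_mem := F.inf_mem
  mem_of_le h hle := F.mem_of_le h (hle n)
  bot_notMem := F.bot_notMem
  mem_or_compl_mem A := F.mem_or_compl_mem ((A : ℕ → B) n)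

/-- The point of the Stone space of a measure algebra given by an ultrafilter that contains all
sets of full measure. -/
def ofUltrafilter {Ω : Type*} [MeasurableSpace Ω] {μ : Measure Ω} (V : Ultrafilter Ω)
    (hV : (V : Filter Ω) ≤ ae μ) : StoneSpace (MeasureAlgebra μ) where
  carrier := {a | Quotient.liftOn a (fun s => (s : Set Ω) ∈ V) fun _ _ h => propext
    (Filter.congr_sets (f := (V : Filter Ω))
      (Filter.EventuallyEq.mem_iff (Filter.EventuallyEq.filter_mono h hV)))}
  top_mem := Filter.univ_mem (f := (V : Filter Ω))
  inf_mem {a b} := Quotient.inductionOn₂ a b fun _ _ h h' => Filter.inter_mem h h'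
  mem_of_le {a b} := Quotient.inductionOn₂ a b fun _ _ h h' =>
    Filter.mp_mem h (hV h')
  bot_notMem := V.empty_notMem
  mem_or_compl_mem a := Quotient.inductionOn a fun s => V.mem_or_compl_mem s

theorem mem_ofUltrafilter_iff {Ω : Type*} [MeasurableSpace Ω] {μ : Measure Ω} (V : Ultrafilter Ω)
    (hV : (V : Filter Ω) ≤ ae μ) (b : MeasureAlgebra μ) :
    b ∈ (ofUltrafilter V hV).carrier ↔ b.rep ∈ V := by
  conv_lhs => rw [← b.mk_rep]
  rfl

/-- Almost every `ω` lies in a cell of positive measure of the partition given by the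
representatives; an ultrafilter containing that cell and all sets of full measure yields `F`. -/
theorem ae_exists_mem_iff {Ω : Type*} [MeasurableSpace Ω] {μ : Measure Ω}
    (T : Finset (MeasureAlgebra μ)) : ∀ᵐ ω ∂μ, ∃ F : StoneSpace (MeasureAlgebra μ),
      ∀ b ∈ T, b ∈ F.carrier ↔ ω ∈ b.rep := by
  classical
  have h : ∀ t ∈ T.powerset, ∀ᵐ ω ∂μ, ω ∈ {x | ∀ b ∈ T, x ∈ b.rep ↔ b ∈ t} →
      ∃ F : StoneSpace (MeasureAlgebra μ), ∀ b ∈ T, b ∈ F.carrier ↔ b ∈ t := by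
    intro t _
    by_cases h0 : μ {x | ∀ b ∈ T, x ∈ b.rep ↔ b ∈ t} = 0
    · filter_upwards [measure_eq_zero_iff_ae_notMem.1 h0] with ω hω h
      exact (hω h).elim
    · have := Filter.frequently_mem_iff_neBot.1 (frequently_ae_mem_iff.2 h0)
      let V := Ultrafilter.of (ae μ ⊓ Filter.principal
        {x | ∀ b ∈ T, x ∈ b.rep ↔ b ∈ t})
      have hV := Ultrafilter.of_le (ae μ ⊓ Filter.principal
        {x | ∀ b ∈ T, x ∈ b.rep ↔ b ∈ t})
      have hA := Filter.le_principal_iff.1 (hV.trans inf_le_right)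
      refine Filter.Eventually.of_forall fun ω _ =>
        ⟨ofUltrafilter V (hV.trans inf_le_left), fun b hb => ?_⟩
      rw [mem_ofUltrafilter_iff]
      constructor
      · intro hbV
        obtain ⟨x, hx, hxb⟩ := V.nonempty_of_mem (Filter.inter_mem hA hbV)
        exact (hx b hb).1 hxb
      · intro hbt
        exact Filter.mem_of_superset hA fun x hx => (hx b hb).2 hbt
  filter_upwards [(Filter.eventually_all_finset _).2 h] with ω hω
  obtain ⟨F, hF⟩ := hω {b ∈ T | ω ∈ b.rep}
    (Finset.mem_powerset.2 (Finset.filter_subset _ _)) fun b hb => by simp [hb]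
  exact ⟨F, fun b hb => by simpa [hb] using hF b hb⟩

end StoneSpace

/-! ### Products of generators span `S(K)` -/

section Generators

variable {B : Type*} [BooleanAlgebra B]

/-- The generator `G_b`, as an element of the algebra that the generators generate. -/
noncomputable def generator (N : PosElem B → Set ℕ) (b : PosElem B) : genAlgebra N :=
  ⟨genElem N b, BooleanSubalgebra.subset_closure ⟨b, rfl⟩⟩

theorem isClopen_forall_generator_mem (N : PosElem B → Set ℕ) (s : Finset (PosElem B)) :
    IsClopen {F : genSpace N | ∀ b ∈ s, generator N b ∈ F.carrier} := by
  have h : {F : genSpace N | ∀ b ∈ s, generator N b ∈ F.carrier} =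
      ⋂ b ∈ s, StoneSpace.hat (generator N b) := by
    ext F
    simp [StoneSpace.hat]
  rw [h]
  exact isClopen_biInter_finset fun b _ => StoneSpace.isClopen_hat _

/-- The product of the characteristic functions of the clopen sets given by the generators `G_b`,
`b ∈ s`. -/
noncomputable def generatorProd (N : PosElem B → Set ℕ) (s : Finset (PosElem B)) :
    C(genSpace N, ℝ) where
  toFun := {F : genSpace N | ∀ b ∈ s, generator N b ∈ F.carrier}.indicator 1
  continuous_toFun := (isClopen_forall_generator_mem N s).continuous_indicator continuous_one

open Classical in
theorem generatorProd_apply (N : PosElem B → Set ℕ) (s : Finset (PosElem B)) (F : genSpace N) :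
    generatorProd N s F = if ∀ b ∈ s, generator N b ∈ F.carrier then 1 else 0 := by
  change Set.indicator _ _ _ = _
  rw [Set.indicator_apply]
  rfl

theorem mul_mem_span_generatorProd (N : PosElem B → Set ℕ) {f g : C(genSpace N, ℝ)}
    (hf : f ∈ Submodule.span ℝ (Set.range (generatorProd N)))
    (hg : g ∈ Submodule.span ℝ (Set.range (generatorProd N))) :
    f * g ∈ Submodule.span ℝ (Set.range (generatorProd N)) := by
  classical
  have h := Submodule.mul_mem_mul hf hg
  rw [Submodule.span_mul_span] at h
  refine Submodule.span_mono ?_ h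
  rintro _ ⟨_, ⟨s, rfl⟩, _, ⟨t, rfl⟩, rfl⟩
  refine ⟨s ∪ t, ?_⟩
  ext F
  rw [ContinuousMap.mul_apply, generatorProd_apply, generatorProd_apply, generatorProd_apply,
    if_congr Finset.forall_mem_union rfl rfl, ite_and]
  split_ifs <;> simp

theorem one_mem_span_generatorProd (N : PosElem B → Set ℕ) :
    (1 : C(genSpace N, ℝ)) ∈ Submodule.span ℝ (Set.range (generatorProd N)) := by
  refine Submodule.subset_span ⟨∅, ?_⟩
  ext F
  simp [generatorProd_apply]

/-- The span contains `1` and is closed under products, so it follows the Boolean operations: `1 -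
f` for complements, `f + g - f * g` for joins. -/
theorem exists_mem_span_eq_indicator_hat (N : PosElem B → Set ℕ) (a : genAlgebra N) :
    ∃ f ∈ Submodule.span ℝ (Set.range (generatorProd N)),
      (f : genSpace N → ℝ) = (StoneSpace.hat a).indicator 1 := by
  classical
  obtain ⟨A, hA⟩ := a
  induction hA using BooleanSubalgebra.closure_bot_sup_induction with
  | mem x hx =>
    obtain ⟨b, rfl⟩ := hx
    refine ⟨generatorProd N {b}, Submodule.subset_span ⟨{b}, rfl⟩, ?_⟩
    ext F
    rw [generatorProd_apply, Set.indicator_apply]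
    exact if_congr ⟨fun h => h b (Finset.mem_singleton_self b),
      fun h c hc => (Finset.mem_singleton.1 hc).symm ▸ h⟩ rfl rfl
  | bot =>
    refine ⟨0, Submodule.zero_mem _, ?_⟩
    ext F
    exact (Set.indicator_of_notMem (s := StoneSpace.hat (⊥ : genAlgebra N)) F.bot_notMem _).symm
  | sup x hx y hy ihx ihy =>
    obtain ⟨f, hf, hf'⟩ := ihx
    obtain ⟨g, hg, hg'⟩ := ihy
    refine ⟨f + g - f * g,
      Submodule.sub_mem _ (Submodule.add_mem _ hf hg) (mul_mem_span_generatorProd N hf hg), ?_⟩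
    ext F
    have h : F ∈ StoneSpace.hat (⟨x, hx⟩ ⊔ ⟨y, hy⟩ : genAlgebra N) ↔
        F ∈ StoneSpace.hat (⟨x, hx⟩ : genAlgebra N) ∨ F ∈ StoneSpace.hat (⟨y, hy⟩ : genAlgebra N) :=
      F.sup_mem_iff _ _
    change f F + g F - f F * g F = (StoneSpace.hat (⟨x, hx⟩ ⊔ ⟨y, hy⟩ : genAlgebra N)).indicator 1 F
    rw [hf', hg', Set.indicator_apply, Set.indicator_apply, Set.indicator_apply]
    by_cases h1 : F ∈ StoneSpace.hat (⟨x, hx⟩ : genAlgebra N) <;>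
      by_cases h2 : F ∈ StoneSpace.hat (⟨y, hy⟩ : genAlgebra N) <;> simp [h, h1, h2]
  | compl x hx ih =>
    obtain ⟨f, hf, hf'⟩ := ih
    refine ⟨1 - f, Submodule.sub_mem _ (one_mem_span_generatorProd N) hf, ?_⟩
    ext F
    have h : F ∈ StoneSpace.hat ((⟨x, hx⟩ : genAlgebra N)ᶜ) ↔
        F ∉ StoneSpace.hat (⟨x, hx⟩ : genAlgebra N) := F.compl_mem_iff _
    change 1 - f F = (StoneSpace.hat ((⟨x, hx⟩ : genAlgebra N)ᶜ)).indicator 1 F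
    rw [hf', Set.indicator_apply, Set.indicator_apply]
    by_cases h1 : F ∈ StoneSpace.hat (⟨x, hx⟩ : genAlgebra N) <;> simp [h, h1]

theorem clopenSpan_genSpace_le (N : PosElem B → Set ℕ) :
    clopenSpan (genSpace N) ≤ Submodule.span ℝ (Set.range (generatorProd N)) := by
  refine Submodule.span_le.2 ?_
  rintro f ⟨U, hU, hf⟩
  obtain ⟨a, rfl⟩ := StoneSpace.exists_eq_hat_of_isClopen hU
  obtain ⟨g, hg, hg'⟩ := exists_mem_span_eq_indicator_hat N a
  rwa [DFunLike.coe_injective (hf.trans hg'.symm)]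

end Generators

/-! ### Functionals obtained by integration -/

section MeasureAlgebra

variable {Ω : Type*} [MeasurableSpace Ω] {μ : Measure Ω}

/-- The intersection of the representatives of the elements of `s`. -/
noncomputable def interRep (s : Finset (PosElem (MeasureAlgebra μ))) : Set Ω :=
  ⋂ b ∈ s, (b : MeasureAlgebra μ).rep

theorem measurableSet_interRep (s : Finset (PosElem (MeasureAlgebra μ))) :
    MeasurableSet (interRep s) :=
  Finset.measurableSet_biInter s fun b _ => (b : MeasureAlgebra μ).measurableSet_rep

/-- Each `G_b` is at most `b` in every coordinate, so the meet of the generators serves as `A`. -/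
theorem exists_mem_le_mk_interRep (N : PosElem (MeasureAlgebra μ) → Set ℕ) (F : genSpace N)
    (s : Finset (PosElem (MeasureAlgebra μ))) (hs : ∀ b ∈ s, generator N b ∈ F.carrier) :
    ∃ A ∈ F.carrier, ∀ n, (A : ℕ → MeasureAlgebra μ) n ≤
      MeasureAlgebra.mk μ ⟨interRep s, measurableSet_interRep s⟩ := by
  classical
  induction s using Finset.induction_on with
  | empty =>
    refine ⟨⊤, F.top_mem, fun n => ?_⟩
    exact Filter.Eventually.of_forall fun ω _ => Set.mem_iInter₂.2 fun b hb => by simp at hb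
  | insert b s _ ih =>
    obtain ⟨A, hA, hAs⟩ := ih fun c hc => hs c (Finset.mem_insert_of_mem hc)
    refine ⟨generator N b ⊓ A, F.inf_mem (hs b (Finset.mem_insert_self _ _)) hA, fun n => ?_⟩
    have h1 : genElem N b n ≤ (b : MeasureAlgebra μ) := by
      rw [genElem]
      split_ifs
      exacts [le_rfl, bot_le]
    have h2 : genElem N b n ⊓ (A : ℕ → MeasureAlgebra μ) n ≤ MeasureAlgebra.mk μ
        ⟨_, (b : MeasureAlgebra μ).measurableSet_rep⟩ ⊓ MeasureAlgebra.mk μ ⟨_, measurableSet_interRep s⟩ :=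
      inf_le_inf (h1.trans (MeasureAlgebra.mk_rep _).ge) (hAs n)
    refine h2.trans ?_
    refine Filter.Eventually.of_forall fun ω hω => ?_
    change ω ∈ interRep (insert b s)
    rw [interRep, Finset.set_biInter_insert]
    exact hω

theorem generatorProd_eq_zero (N : PosElem (MeasureAlgebra μ) → Set ℕ)
    {s : Finset (PosElem (MeasureAlgebra μ))} (h : μ (interRep s) = 0) : generatorProd N s = 0 := by
  classical
  ext F
  rw [generatorProd_apply, if_neg]
  · rfl
  · intro hs
    obtain ⟨A, hA, hAs⟩ := exists_mem_le_mk_interRep N F s hs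
    refine F.bot_notMem (F.mem_of_le hA fun n => (hAs n).trans ?_)
    exact (ae_eq_empty.2 h).le

open Classical in
/-- The coefficients `μ (⋂ b ∈ s, b)` if `s ⊆ D`, and zero otherwise. -/
noncomputable def weightOn (D : Set (PosElem (MeasureAlgebra μ)))
    (s : Finset (PosElem (MeasureAlgebra μ))) : ℝ :=
  if (s : Set (PosElem (MeasureAlgebra μ))) ⊆ D then μ.real (interRep s) else 0

/-- At a coordinate that realises `D` on the indices in use, the combination takes the values of a
simple function almost everywhere; integration against a probability measure does not exceed the sup
norm. -/
theorem abs_linearCombination_weightOn_le [IsProbabilityMeasure μ]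
    {N : PosElem (MeasureAlgebra μ) → Set ℕ} (hN : IsIndependentFamily N)
    (D : Set (PosElem (MeasureAlgebra μ))) (v : Finset (PosElem (MeasureAlgebra μ)) →₀ ℝ) :
    |Finsupp.linearCombination ℝ (weightOn D) v| ≤
      ‖Finsupp.linearCombination ℝ (generatorProd N) v‖ := by
  classical
  let T : Finset (PosElem (MeasureAlgebra μ)) := v.support.biUnion id
  obtain ⟨n, hn⟩ : ∃ n, ∀ b ∈ T, n ∈ N b ↔ b ∈ D := by
    obtain ⟨n, hn, hn'⟩ := hN {b ∈ T | b ∈ D} {b ∈ T | b ∉ D}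
      (Finset.disjoint_filter_filter_not _ _ _)
    refine ⟨n, fun b hb => ⟨fun hnb => ?_, fun hbD => ?_⟩⟩
    · by_contra hbD
      exact hn' (Set.mem_biUnion (Finset.mem_filter.2 ⟨hb, hbD⟩) hnb)
    · exact Set.mem_iInter₂.1 hn b (Finset.mem_filter.2 ⟨hb, hbD⟩)
  let f : Ω → ℝ := fun ω => ∑ s ∈ v.support,
    if (s : Set (PosElem (MeasureAlgebra μ))) ⊆ D then (interRep s).indicator (fun _ => v s) ω else 0
  have hf : Finsupp.linearCombination ℝ (weightOn D) v = ∫ ω, f ω ∂μ := by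
    rw [Finsupp.linearCombination_apply, Finsupp.sum, integral_finsetSum]
    · refine Finset.sum_congr rfl fun s _ => ?_
      by_cases hs : (s : Set (PosElem (MeasureAlgebra μ))) ⊆ D
      · simp only [weightOn, if_pos hs]
        rw [integral_indicator_const _ (measurableSet_interRep s), smul_eq_mul, smul_eq_mul,
          mul_comm]
      · simp [weightOn, if_neg hs]
    · intro s _
      by_cases hs : (s : Set (PosElem (MeasureAlgebra μ))) ⊆ D
      · simp only [if_pos hs]
        exact (integrable_const _).indicator (measurableSet_interRep s)
      · simp only [if_neg hs]
        exact integrable_zero _ _ _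
  have hbound : ∀ᵐ ω ∂μ, ‖f ω‖ ≤ ‖Finsupp.linearCombination ℝ (generatorProd N) v‖ := by
    filter_upwards [StoneSpace.ae_exists_mem_iff (T.image Subtype.val)] with ω hω
    obtain ⟨F, hF⟩ := hω
    have hgen : ∀ b ∈ T, generator N b ∈ (StoneSpace.ofCoord n F : genSpace N).carrier ↔
        b ∈ D ∧ ω ∈ (b : MeasureAlgebra μ).rep := by
      intro b hb
      have h1 : generator N b ∈ (StoneSpace.ofCoord n F : genSpace N).carrier ↔
        genElem N b n ∈ F.carrier := Iff.rfl
      rw [h1, genElem, ← hF b (Finset.mem_image_of_mem _ hb), ← hn b hb]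
      by_cases hnb : n ∈ N b
      · simp [hnb]
      · simp [hnb, F.bot_notMem]
    -- A term with `s` not inside `D` vanishes here, as it contains a generator that is `0` at `n`.
    have hval : f ω = Finsupp.linearCombination ℝ (generatorProd N) v (StoneSpace.ofCoord n F) := by
      rw [Finsupp.linearCombination_apply, Finsupp.sum, ContinuousMap.sum_apply]
      refine Finset.sum_congr rfl fun s hs => ?_
      have hsT : ∀ b ∈ s, b ∈ T := fun b hb => Finset.mem_biUnion.2 ⟨s, hs, hb⟩
      have h2 : (∀ b ∈ s, generator N b ∈ (StoneSpace.ofCoord n F : genSpace N).carrier) ↔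
          (s : Set (PosElem (MeasureAlgebra μ))) ⊆ D ∧ ω ∈ interRep s := by
        rw [interRep, Set.mem_iInter₂]
        exact (forall₂_congr fun b hb => hgen b (hsT b hb)).trans forall₂_and
      rw [ContinuousMap.smul_apply, generatorProd_apply, if_congr h2 rfl rfl, Set.indicator_apply]
      by_cases h3 : (s : Set (PosElem (MeasureAlgebra μ))) ⊆ D <;>
        by_cases h4 : ω ∈ interRep s <;> simp [h3, h4]
    rw [hval]
    exact ContinuousMap.norm_coe_le_norm _ _
  rw [hf]
  simpa using norm_integral_le_of_norm_le_const hbound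

end MeasureAlgebra

/-! ### The norm on `S(K)` -/

theorem theorem3 {I : Type*} (hI : ℵ₁ ≤ #I) (hI' : #I ≤ 𝔠)
    (N : PosElem (CoinAlgebra I) → Set ℕ) (hN : IsIndependentFamily N)
    (hc : IsKunenCardinal.{0} 𝔠) :
    Measurable[(weakBaire C(genSpace N, ℝ)).comap
        (Subtype.val : clopenSpan (genSpace N) → C(genSpace N, ℝ)), borel ℝ]
      (fun g : clopenSpan (genSpace N) => ‖(g : C(genSpace N, ℝ))‖) := by
  classical
  have hprob : IsProbabilityMeasure (coinMeasure I) := by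
    unfold coinMeasure
    infer_instance
  have hX : #(PosElem (CoinAlgebra I)) ≤ 𝔠 :=
    (Cardinal.mk_subtype_le _).trans (mk_coinAlgebra_le_continuum hI')
  have hrep : ∀ g : clopenSpan (genSpace N), ∃ v,
      Finsupp.linearCombination ℝ (generatorProd N) v = (g : C(genSpace N, ℝ)) := fun g => by
    have h := clopenSpan_genSpace_le N g.2
    rwa [← Finsupp.range_linearCombination] at h
  -- The choice is arbitrary; measurability is shown only for sums of the weighted coefficients `c g
  -- s * m s`.
  choose c hcg using hrep
  let m : Finset (PosElem (CoinAlgebra I)) → ℝ := fun s => (coinMeasure I).real (interRep s)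
  let a : clopenSpan (genSpace N) → Finset (PosElem (CoinAlgebra I)) →₀ ℝ := fun g =>
    Finsupp.zipWith (· * ·) (mul_zero 0) (c g)
      (Finsupp.onFinset (c g).support (fun s => if s ∈ (c g).support then m s else 0)
        fun s hs => by by_contra h; simp [h] at hs)
  have ha : ∀ g s, a g s = c g s * m s := by
    intro g s
    by_cases h : s ∈ (c g).support
    · simp [a, Finsupp.mem_support_iff.1 h]
    · simp [a, Finsupp.notMem_support_iff.1 h]
  have hsupp : ∀ g, (a g).support ⊆ (c g).support := fun g s hs => by
    rw [Finsupp.mem_support_iff, ha] at hs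
    exact Finsupp.mem_support_iff.2 (left_ne_zero_of_mul hs)
  let : MeasurableSpace (clopenSpan (genSpace N)) := (weakBaire C(genSpace N, ℝ)).comap Subtype.val
  have hmeas : ∀ D : Set (PosElem (CoinAlgebra I)), Measurable fun g =>
      sumOn {s : Finset (PosElem (CoinAlgebra I)) | (s : Set (PosElem (CoinAlgebra I))) ⊆ D} (a g) := by
    intro D
    obtain ⟨φ, hφ⟩ := exists_dual_comp_eq _ _ (abs_linearCombination_weightOn_le hN D)
    have h : (fun g => sumOn {s : Finset (PosElem (CoinAlgebra I)) |
        (s : Set (PosElem (CoinAlgebra I))) ⊆ D} (a g)) = fun g => φ g.1 := by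
      ext g
      rw [← hcg g, hφ, Finsupp.linearCombination_apply, Finsupp.sum, sumOn]
      rw [Finset.sum_subset (hsupp g)]
      · refine Finset.sum_congr rfl fun s _ => ?_
        rw [Set.indicator_apply, ha, weightOn, smul_eq_mul, mul_ite, mul_zero]
        rfl
      · intro s _ hs
        rw [Set.indicator_apply, Finsupp.notMem_support_iff.1 hs, ite_self]
    rw [h]
    exact @Measurable.comp _ _ _ _ (weakBaire C(genSpace N, ℝ)) _ _ _ (measurable_weakBaire φ)
      (@comap_measurable _ _ (weakBaire C(genSpace N, ℝ)) _)
  -- The factor `(m s)⁻¹` undoes the weights in `a`, so that the sum is `g` again.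
  have hnorm := hc.measurable_norm_sum (mk_finset_le_continuum hX) (hc.measurable_sumOn hX hmeas)
    fun s => (m s)⁻¹ • generatorProd N s
  refine Eq.subst (motive := fun f : clopenSpan (genSpace N) → ℝ => Measurable[_, borel ℝ] f)
    (funext fun g => ?_) hnorm
  rw [← hcg g, Finsupp.linearCombination_apply, Finsupp.sum, Finsupp.sum,
    Finset.sum_subset (hsupp g) fun s _ hs => by rw [Finsupp.notMem_support_iff.1 hs, zero_smul]]
  congr 1
  refine Finset.sum_congr rfl fun s _ => ?_
  -- A zero weight loses the coefficient, but then the product itself is zero.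
  by_cases hs : m s = 0
  · rw [generatorProd_eq_zero N ((measureReal_eq_zero_iff).1 hs), smul_zero, smul_zero, smul_zero]
  · rw [ha, smul_smul, mul_assoc, mul_inv_cancel₀ hs, mul_one]
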